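/- A $*$-category is a $\mathbb{C}$-linear category with an antilinear involution $f\mapsto f^*$, $\mathrm{Hom}(X,Y)\to\mathrm{Hom}(Y,X)$, satisfying $(fg)^*=g^*f^*$. It is a $W^*$-category if $\mathrm{End}(X)$ is a $W^*$-algebra ($*$-isomorphic to a von Neumann algebra on a Hilbert space) for every formal finite direct sum $X$ of objects. A functor of $W^*$-categories is a linear $*$-functor inducing normal homomorphisms on these endomorphism algebras. The idempotent completion $\hat C$ has as objects the pairs $(x,p)$ with $p\in\mathrm{End}(x)$, $p^2=p^*=p$, and $\mathrm{Hom}((x_1,p_1),(x_2,p_2))=p_2\,\mathrm{Hom}(x_1,x_2)\,p_1$. A family $\{c_i\}$ generates $C$ if every non-zero object of $\hat C$ receives a non-zero morphism from some $c_i$; a generator is an object that by itself generates $C$. A subobject of $c$ is an object $y$ with an isometry $\iota:y\to c$, $\iota^*\iota=\mathrm{id}_y$. An orthogonal direct sum of $\{c_i\}_{i\in I}$ is an object $x$ with maps $\iota_i:c_i\to x$ such that $\iota_i^*\iota_j=\delta_{ij}\,\mathrm{id}_{c_i}$ and $\sum_i\iota_i\iota_i^*=\mathrm{id}_x$ (supremum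 of the finite partial sums). Let $\kappa$ be an infinite cardinal. A von Neumann algebra is $\kappa$-separable if it has a faithful normal unital representation on a Hilbert space with an orthonormal basis of cardinality $<\kappa$. A $W^*$-category $C$ is $\kappa$-small if $\mathrm{End}(c)$ is $\kappa$-separable for every object $c$ and $C$ is generated by a family of fewer than $\kappa$ objects. It is $\kappa$-complete if every projection $p=p^2=p^*:x\to x$ splits (there is $\iota:y\to x$ with $\iota\iota^*=p$, $\iota^*\iota=\mathrm{id}_y$) and every family of fewer than $\kappa$ objects has an orthogonal direct sum. **Statement.** Let $\kappa=\aleph_{\alpha+1}$ be a successor cardinal, and let $C$ be a $\kappa$-small $\kappa$-complete $W^*$-category. Then: 1. There exists a generator $c\in C$ such that every object of $C$ is isomorphic to a subobject of $c$. Such an object $c$ is unique up to (unitary) isomorphism. 2. There exists a $\kappa$-separable von Neumann algebra $A$ such that $C$ is equivalent, as a $W^*$-category, to $\widehat{\mathbf{B}A}$, the idempotent completion (without direct sum completion) of the one-object category $\mathbf{B}A$ with endomorphism algebra $A$. That is, there are functors of $W^*$-categories in both directions that are inverse to each other up to unitary natural isomorphisms. -/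

import Mathlib

open CategoryTheory

universe v u u'

namespace WCat

/-! ### W*-algebras, normal maps, separability -/

section Algebra

/-- The order of a *-algebra: `a ≤ b` iff `b - a` is positive, i.e. of the form `t* t`. -/
def StarLE {A : Type v} [Ring A] [Star A] (a b : A) : Prop :=
  ∃ t : A, b - a = star t * t

/-- `s` is the supremum of the set `S` for the order of a *-algebra. -/
def IsStarSup {A : Type v} [Ring A] [Star A] (S : Set A) (s : A) : Prop :=
  (∀ a ∈ S, StarLE a s) ∧ ∀ b : A, (∀ a ∈ S, StarLE a b) → StarLE s b

/-- A map is normal if it preserves suprema of bounded increasing nets of positive elements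
(equivalently, of non-empty upward directed sets of positive elements that have a supremum). -/
def IsNormalMap {A : Type v} {B : Type u} [Ring A] [Star A] [Ring B] [Star B] (f : A → B) : Prop :=
  ∀ S : Set A, S.Nonempty → DirectedOn StarLE S → (∀ a ∈ S, StarLE 0 a) →
    ∀ s : A, IsStarSup S s → IsStarSup (f '' S) (f s)

/-- A W*-algebra (abstract von Neumann algebra): a *-algebra that is *-isomorphic to a
von Neumann algebra on some Hilbert space. -/
def IsWStarAlgebra (A : Type v) [Ring A] [StarRing A] [Algebra ℂ A] : Prop :=
  ∃ (H : Type v) (_ : NormedAddCommGroup H) (_ : InnerProductSpace ℂ H) (_ : CompleteSpace H)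
    (M : VonNeumannAlgebra H), Nonempty (A ≃⋆ₐ[ℂ] M.toStarSubalgebra)

/-- A Hilbert space is `κ`-separable if it has a Hilbert basis of cardinality `< κ`. -/
def IsKappaSeparableHilbert (κ : Cardinal.{v}) (H : Type v) [NormedAddCommGroup H]
    [InnerProductSpace ℂ H] : Prop :=
  ∃ I : Type v, Cardinal.mk I < κ ∧ Nonempty (HilbertBasis I ℂ H)

/-- A von Neumann algebra is `κ`-separable if it has a faithful (normal, unital)
representation on a `κ`-separable Hilbert space. -/
def IsKappaSeparable (κ : Cardinal.{v}) (A : Type v) [Ring A] [StarRing A] [Algebra ℂ A] : Prop :=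
  IsWStarAlgebra A ∧
    ∃ (H : Type v) (_ : NormedAddCommGroup H) (_ : InnerProductSpace ℂ H) (_ : CompleteSpace H)
      (π : A →⋆ₐ[ℂ] (H →L[ℂ] H)),
      IsKappaSeparableHilbert κ H ∧ Function.Injective π ∧ IsNormalMap π

end Algebra

/-! ### *-categories -/

/-- A *-category: a `ℂ`-linear category with an antilinear involution `adj`
reversing the direction of morphisms (and fixing objects). -/
class StarCategory (C : Type u) [Category.{v} C] [Preadditive C] [Linear ℂ C] where
  adj : ∀ {X Y : C}, (X ⟶ Y) → (Y ⟶ X)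
  adj_adj : ∀ {X Y : C} (f : X ⟶ Y), adj (adj f) = f
  adj_comp : ∀ {X Y Z : C} (f : X ⟶ Y) (g : Y ⟶ Z), adj (f ≫ g) = adj g ≫ adj f
  adj_add : ∀ {X Y : C} (f g : X ⟶ Y), adj (f + g) = adj f + adj g
  adj_smul : ∀ {X Y : C} (z : ℂ) (f : X ⟶ Y), adj (z • f) = star z • adj f

open StarCategory (adj)

section StarCategory

variable {C : Type u} [Category.{v} C] [Preadditive C] [Linear ℂ C] [StarCategory C]

theorem adj_zero (X Y : C) : adj (0 : X ⟶ Y) = 0 := by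
  have h := StarCategory.adj_add (0 : X ⟶ Y) 0
  rw [add_zero] at h
  exact left_eq_add.mp h

theorem adj_sum {X Y : C} {ι : Type*} (s : Finset ι) (f : ι → (X ⟶ Y)) :
    adj (∑ i ∈ s, f i) = ∑ i ∈ s, adj (f i) := by
  classical
  induction s using Finset.induction_on with
  | empty => simpa using adj_zero X Y
  | insert a s ha ih =>
    rw [Finset.sum_insert ha, Finset.sum_insert ha, StarCategory.adj_add, ih]

/-- The *-algebra structure on endomorphisms. In `End X`, the product `f * g` is `f ∘ g`. -/
instance instStarRingEnd (X : C) : StarRing (End X) where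
  star f := (adj (f : X ⟶ X) : X ⟶ X)
  star_involutive f := StarCategory.adj_adj (f : X ⟶ X)
  star_mul f g := StarCategory.adj_comp (g : X ⟶ X) (f : X ⟶ X)
  star_add f g := StarCategory.adj_add (f : X ⟶ X) (g : X ⟶ X)

/-- `ι : Y ⟶ X` is an isometry: `ι* ∘ ι = id`. -/
def IsIsometry {X Y : C} (f : Y ⟶ X) : Prop := f ≫ adj f = 𝟙 Y

/-- An isomorphism is unitary if its inverse is its adjoint. -/
def IsUnitaryIso {X Y : C} (e : X ≅ Y) : Prop := e.inv = adj e.hom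

end StarCategory

/-! ### Finite direct sums -/

section Mat

variable {C : Type u} [Category.{v} C] [Preadditive C] [Linear ℂ C]

/-- `Mat_ C`, the category of formal finite direct sums of objects of `C`, is `ℂ`-linear. -/
instance instLinearMat : Linear ℂ (Mat_ C) where
  homModule M N := inferInstanceAs <| Module ℂ (∀ (i : M.ι) (j : N.ι), M.X i ⟶ N.X j)
  smul_comp M N K z f g := by
    ext i k
    change ∑ j, (z • f i j) ≫ g j k = z • ∑ j, f i j ≫ g j k
    simp [Finset.smul_sum]
  comp_smul M N K f z g := by
    ext i k
    change ∑ j, f i j ≫ (z • g j k) = z • ∑ j, f i j ≫ g j k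
    simp [Finset.smul_sum]

/-- The adjoint of a matrix of morphisms is the transposed matrix of adjoints. -/
instance instStarCategoryMat [StarCategory C] : StarCategory (Mat_ C) where
  adj f := fun j i => adj (f i j)
  adj_adj f := by
    ext i j
    exact StarCategory.adj_adj _
  adj_comp f g := by
    ext k i
    change adj (∑ j, f i j ≫ g j k) = ∑ j, adj (g j k) ≫ adj (f i j)
    rw [adj_sum]
    exact Finset.sum_congr rfl fun j _ => StarCategory.adj_comp _ _
  adj_add f g := by
    ext j i
    exact StarCategory.adj_add _ _
  adj_smul z f := by
    ext j i
    exact StarCategory.adj_smul z (f i j)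

end Mat

/-! ### The idempotent completion -/

/-- Objects of the idempotent completion: pairs `(X, p)` with `p : X ⟶ X`, `p² = p* = p`. -/
structure IdemCompletion (C : Type u) [Category.{v} C] [Preadditive C] [Linear ℂ C]
    [StarCategory C] where
  X : C
  p : X ⟶ X
  idem : p ≫ p = p
  selfAdj : adj p = p

namespace IdemCompletion

variable {C : Type u} [Category.{v} C] [Preadditive C] [Linear ℂ C] [StarCategory C]

/-- `Hom((X₁, p₁), (X₂, p₂)) = p₂ Hom(X₁, X₂) p₁`, i.e. the morphisms `f : X₁ ⟶ X₂` with
`p₂ f p₁ = f`. -/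
def homs (P Q : IdemCompletion C) : Submodule ℂ (P.X ⟶ Q.X) where
  carrier := {f | P.p ≫ f ≫ Q.p = f}
  add_mem' {f g} hf hg := by
    simp only [Set.mem_ofPred_eq] at *
    rw [Preadditive.add_comp, Preadditive.comp_add, hf, hg]
  zero_mem' := by simp
  smul_mem' z f hf := by
    simp only [Set.mem_ofPred_eq] at *
    rw [Linear.smul_comp, Linear.comp_smul, hf]

theorem p_comp {P Q : IdemCompletion C} (f : homs P Q) : P.p ≫ f.1 = f.1 := by
  have h : P.p ≫ f.1 ≫ Q.p = f.1 := f.2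
  rw [← h, ← Category.assoc P.p P.p, P.idem]

theorem comp_p {P Q : IdemCompletion C} (f : homs P Q) : f.1 ≫ Q.p = f.1 := by
  have h : P.p ≫ f.1 ≫ Q.p = f.1 := f.2
  rw [← h]
  simp only [Category.assoc, Q.idem]

instance instCategory : Category.{v} (IdemCompletion C) where
  Hom P Q := homs P Q
  id P := ⟨P.p, by
    change P.p ≫ P.p ≫ P.p = P.p
    rw [P.idem, P.idem]⟩
  comp {P Q R} f g := ⟨f.1 ≫ g.1, by
    change P.p ≫ (f.1 ≫ g.1) ≫ R.p = f.1 ≫ g.1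
    rw [Category.assoc, comp_p g, ← Category.assoc, p_comp f]⟩
  id_comp f := Subtype.ext (p_comp f)
  comp_id f := Subtype.ext (comp_p f)
  assoc f g h := Subtype.ext (Category.assoc f.1 g.1 h.1)

instance instPreadditive : Preadditive (IdemCompletion C) where
  homGroup P Q := inferInstanceAs <| AddCommGroup (homs P Q)
  add_comp _ _ _ f f' g := Subtype.ext (Preadditive.add_comp _ _ _ f.1 f'.1 g.1)
  comp_add _ _ _ f g g' := Subtype.ext (Preadditive.comp_add _ _ _ f.1 g.1 g'.1)

instance instLinear : Linear ℂ (IdemCompletion C) where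
  homModule P Q := inferInstanceAs <| Module ℂ (homs P Q)
  smul_comp _ _ _ z f g := Subtype.ext (Linear.smul_comp _ _ _ z f.1 g.1)
  comp_smul _ _ _ f z g := Subtype.ext (Linear.comp_smul _ _ _ f.1 z g.1)

instance instStarCategory : StarCategory (IdemCompletion C) where
  adj {P Q} f := ⟨adj f.1, by
    have h : P.p ≫ f.1 ≫ Q.p = f.1 := f.2
    change Q.p ≫ adj f.1 ≫ P.p = adj f.1
    conv_rhs => rw [← h]
    rw [StarCategory.adj_comp, StarCategory.adj_comp, P.selfAdj, Q.selfAdj, Category.assoc]⟩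
  adj_adj f := Subtype.ext (StarCategory.adj_adj f.1)
  adj_comp f g := Subtype.ext (StarCategory.adj_comp f.1 g.1)
  adj_add f g := Subtype.ext (StarCategory.adj_add f.1 g.1)
  adj_smul z f := Subtype.ext (StarCategory.adj_smul z f.1)

/-- The object `(X, id)` of the idempotent completion. -/
def of (X : C) : IdemCompletion C where
  X := X
  p := 𝟙 X
  idem := Category.comp_id _
  selfAdj := by
    have h := StarCategory.adj_comp (adj (𝟙 X)) (𝟙 X)
    rw [Category.comp_id, StarCategory.adj_adj, Category.comp_id] at h
    exact h.symm

end IdemCompletion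

/-! ### The one-object category of an algebra -/

section SingleObj

variable (A : Type v) [Ring A] [StarRing A] [Algebra ℂ A]

/-- `𝐁A` is `SingleObj A`: one object, with endomorphism algebra `A`. -/
instance instLinearSingleObj : Linear ℂ (SingleObj A) where
  homModule _ _ := inferInstanceAs <| Module ℂ A
  smul_comp _ _ _ z (f : A) (g : A) := mul_smul_comm z g f
  comp_smul _ _ _ (f : A) z (g : A) := smul_mul_assoc z g f

instance instStarCategorySingleObj [StarModule ℂ A] : StarCategory (SingleObj A) where
  adj (f : A) := (star f : A)
  adj_adj (f : A) := star_star f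
  adj_comp (f : A) (g : A) := star_mul g f
  adj_add (f : A) (g : A) := star_add f g
  adj_smul z (f : A) := star_smul z f

end SingleObj

/-! ### W*-categories -/

section WStarCategory

variable (C : Type u) [Category.{v} C] [Preadditive C] [Linear ℂ C] [StarCategory C]

/-- A W*-category: a *-category such that `End X` is a W*-algebra for every formal finite
direct sum `X` of objects. -/
def IsWStarCategory : Prop := ∀ X : Mat_ C, IsWStarAlgebra (End X)

/-- Every projection splits. -/
def IsIdempotentComplete : Prop :=
  ∀ (x : C) (p : x ⟶ x), p ≫ p = p → adj p = p →
    ∃ (y : C) (i : y ⟶ x), adj i ≫ i = p ∧ i ≫ adj i = 𝟙 y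

variable {C}

/-- A family of objects generates `C` if every non-zero object of the idempotent completion
receives a non-zero map from a member of the family. -/
def IsGenerating {I : Type*} (c : I → C) : Prop :=
  ∀ P : IdemCompletion C, ¬ Limits.IsZero P →
    ∃ (i : I) (f : IdemCompletion.of (c i) ⟶ P), f ≠ 0

/-- A single object that generates `C`. -/
def IsGenerator (c : C) : Prop := IsGenerating fun _ : Unit => c

/-- `x`, with the maps `inc i : c i ⟶ x`, is an orthogonal direct sum of the family `c`:
`(inc i)* ∘ inc j = δ_{ij}`, and the supremum of the finite partial sums of
`inc i ∘ (inc i)*` is the identity. -/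
def IsOrthogonalDirectSum {I : Type*} (c : I → C) (x : C) (inc : ∀ i, c i ⟶ x) : Prop :=
  (∀ i, inc i ≫ adj (inc i) = 𝟙 (c i)) ∧
  (∀ i j, i ≠ j → inc j ≫ adj (inc i) = 0) ∧
  IsStarSup (A := End x)
    (Set.range fun F : Finset I => (∑ i ∈ F, adj (inc i) ≫ inc i : x ⟶ x)) (𝟙 x)

variable (C)

/-- All orthogonal direct sums indexed by sets of cardinality `< κ` exist. -/
def HasKappaSmallSums (κ : Cardinal.{v}) : Prop :=
  ∀ (I : Type v), Cardinal.mk I < κ → ∀ c : I → C,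
    ∃ (x : C) (inc : ∀ i, c i ⟶ x), IsOrthogonalDirectSum c x inc

/-- `κ`-complete (`κ`-Cauchy complete). -/
def IsKappaComplete (κ : Cardinal.{v}) : Prop :=
  IsIdempotentComplete C ∧ HasKappaSmallSums C κ

/-- `κ`-small: all endomorphism algebras are `κ`-separable, and there is a set of fewer than
`κ` generators. -/
def IsKappaSmall (κ : Cardinal.{v}) : Prop :=
  (∀ c : C, IsKappaSeparable κ (End c)) ∧
    ∃ (I : Type v) (c : I → C), Cardinal.mk I < κ ∧ IsGenerating c

variable {C}

/-- A generator such that every object is isomorphic to a subobject of it. -/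
def IsMaximal (c : C) : Prop :=
  IsGenerator c ∧ ∀ y : C, ∃ (y' : C) (i : y' ⟶ c), IsIsometry i ∧ Nonempty (y ≅ y')

end WStarCategory

/-! ### Functors and equivalences -/

section Functors

variable {C : Type u} [Category.{v} C] [Preadditive C] [Linear ℂ C] [StarCategory C]
variable {D : Type u'} [Category.{v} D] [Preadditive D] [Linear ℂ D] [StarCategory D]

/-- A functor of W*-categories: a linear *-functor inducing normal homomorphisms
`End X → End (F X)` for every formal finite direct sum `X` of objects. -/
structure IsWStarFunctor (F : C ⥤ D) : Prop where
  additive : F.Additive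
  linear : F.Linear ℂ
  map_adj : ∀ {X Y : C} (f : X ⟶ Y), F.map (adj f) = adj (F.map f)
  normal : ∀ X : Mat_ C,
    IsNormalMap (A := End X) (B := End (F.mapMat_.obj X)) fun f => F.mapMat_.map f

variable (C D)

/-- Equivalence of W*-categories: functors of W*-categories in both directions, mutually inverse
up to unitary (in particular bounded) natural isomorphisms. -/
def WStarEquivalent : Prop :=
  ∃ e : C ≌ D, IsWStarFunctor e.functor ∧ IsWStarFunctor e.inverse ∧
    (∀ X : C, IsUnitaryIso (e.unitIso.app X)) ∧ (∀ Y : D, IsUnitaryIso (e.counitIso.app Y))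

end Functors

end WCat

/-! The object `c` is an orthogonal direct sum of `ℵ_α` copies of each generator, which has fewer
than `κ = ℵ_{α+1}` summands. To embed an object `y` in it, take a maximal family of non-zero partial
isometries from generators into `y` with orthogonal ranges. The range projections are orthogonal in
`End y`, so separability allows at most `ℵ_α` of them, and each member can be assigned a copy of its
source inside `c` that no other member uses. The adjoints, followed by the inclusions of these
copies, sum to a partial isometry `y ⟶ c`. Its initial projection is the identity: otherwise a
generator would map non-trivially to the complement, and the polar part of that map would enlarge
the family (`exists_isometry_of_isGenerating`).

Uniqueness is Schröder–Bernstein for isometries (`exists_unitaryIso`). For the second claim `A = End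
c`: an object corresponds to the range projection of its embedding, and conversely projections of
`c` split.

The analytic input is polar decomposition and summation of orthogonal partial isometries. Both come
from one extension argument on a Hilbert space plus the double commutant theorem, and reach
morphisms `x ⟶ y` as off-diagonal entries of `End (x ⊕ y)`. To survive these transfers they are
stated without vectors or topology: control of the supports of `v` becomes annihilation clauses such
as `h * t = 0 → h * v = 0`. -/

namespace WCat

open StarCategory (adj)

/-! ### Partial isometries in a concrete von Neumann algebra. -/

section Operators

open ContinuousLinearMap

local notation "⟪" x ", " y "⟫" => inner ℂ x y

variable {H : Type v} [NormedAddCommGroup H] [InnerProductSpace ℂ H]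

/-- Polarization. It is what makes the adjoint of the intertwiner of `a` and `b` computable from
equality of norms alone. -/
theorem inner_eq_of_norm_eq {N : Type*} [AddCommGroup N] [Module ℂ N] {a b : N →ₗ[ℂ] H}
    (h : ∀ n, ‖a n‖ = ‖b n‖) (m n : N) : ⟪a m, a n⟫ = ⟪b m, b n⟫ := by
  rw [inner_eq_sum_norm_sq_div_four, inner_eq_sum_norm_sq_div_four]
  simp only [← map_add, ← map_sub, ← map_smul, h]

variable [CompleteSpace H]

/-- Continuous linear maps agreeing on the range of `a` and on its orthogonal complement
are equal. -/
theorem clm_ext_range_orthogonal {N F : Type*} [AddCommGroup N] [Module ℂ N]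
    [NormedAddCommGroup F] [NormedSpace ℂ F] (a : N →ₗ[ℂ] H) {S T : H →L[ℂ] F}
    (h₁ : ∀ n, S (a n) = T (a n))
    (h₂ : ∀ x, (∀ n, ⟪a n, x⟫ = 0) → S x = T x) : S = T := by
  have hcl : (LinearMap.range a).topologicalClosure ≤
      LinearMap.eqLocus S.toLinearMap T.toLinearMap := by
    refine Submodule.topologicalClosure_minimal _ ?_ (isClosed_eq S.continuous T.continuous)
    rintro _ ⟨n, rfl⟩
    exact h₁ n
  ext x
  obtain ⟨y, hy, z, hz, rfl⟩ :=
    (LinearMap.range a).topologicalClosure.exists_add_mem_mem_orthogonal x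
  have hy' : S y = T y := hcl hy
  have hz' : S z = T z := h₂ z fun n =>
    hz _ (Submodule.le_topologicalClosure _ ⟨n, rfl⟩)
  rw [map_add, map_add, hy', hz']

/-- Two linear maps `a`, `b` into a Hilbert space with `‖a n‖ = ‖b n‖` are intertwined by a
partial isometry from the closure of the range of `a` onto the closure of the range of `b`. -/
theorem exists_partialIsometry {N : Type*} [AddCommGroup N] [Module ℂ N] (a b : N →ₗ[ℂ] H)
    (h : ∀ n, ‖a n‖ = ‖b n‖) :
    ∃ V : H →L[ℂ] H, (∀ n, V (a n) = b n) ∧ (∀ x, (∀ n, ⟪a n, x⟫ = 0) → V x = 0) ∧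
      (∀ n, star V (b n) = a n) ∧ (∀ x, (∀ n, ⟪b n, x⟫ = 0) → star V x = 0) := by
  set K := (LinearMap.range a).topologicalClosure with hK
  have haK : ∀ n, a n ∈ K := fun n => Submodule.le_topologicalClosure _ ⟨n, rfl⟩
  let a' : N →ₗ[ℂ] K := a.codRestrict K haK
  have hd : DenseRange a' := by
    intro x
    rw [Topology.IsInducing.subtypeVal.closure_eq_preimage_closure_image]
    have hx : (x : H) ∈ closure (LinearMap.range a : Set H) := x.2
    refine closure_mono ?_ hx
    rintro _ ⟨n, rfl⟩
    exact ⟨a' n, ⟨n, rfl⟩, rfl⟩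
  -- Equality of norms makes `a n ↦ b n` well defined and isometric, so it extends to the closure
  -- `K` of the range of `a`; the projection onto `K` makes it vanish on `Kᗮ`.
  let V : H →L[ℂ] H := (b.extendOfNorm a').comp K.orthogonalProjectionOnto
  have hV : ∀ n, V (a n) = b n := by
    intro n
    have h1 : K.orthogonalProjectionOnto (a n) = a' n :=
      K.orthogonalProjectionOnto_mem_subspace_eq_self (a' n)
    change b.extendOfNorm a' (K.orthogonalProjectionOnto (a n)) = b n
    rw [h1]
    exact LinearMap.extendOfNorm_eq hd ⟨1, fun m => by rw [one_mul, ← h m]; exact le_refl ‖a m‖⟩ n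
  have hV0 : ∀ x, (∀ n, ⟪a n, x⟫ = 0) → V x = 0 := by
    intro x hx
    have hxK : x ∈ Kᗮ := by
      rw [hK, Submodule.orthogonal_closure]
      rintro _ ⟨n, rfl⟩
      exact hx n
    change b.extendOfNorm a' (K.orthogonalProjectionOnto x) = 0
    rw [Submodule.orthogonalProjectionOnto_apply_of_mem_orthogonal hxK, map_zero]
  -- A vector `z` equals `star V y` once the functionals `⟪z, ·⟫` and `⟪y, V ·⟫` agree on the range
  -- of `a` and on its orthogonal complement.
  have key : ∀ y z : H, (∀ n, ⟪z, a n⟫ = ⟪y, b n⟫) → (∀ x, (∀ n, ⟪a n, x⟫ = 0) → ⟪z, x⟫ = 0) →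
      star V y = z := by
    intro y z h1 h2
    have : innerSL ℂ z = (innerSL ℂ y).comp V :=
      clm_ext_range_orthogonal a (fun n => by simp [h1, hV]) (fun x hx => by simp [h2 x hx, hV0 x hx])
    refine ext_inner_right ℂ fun x => ?_
    rw [star_eq_adjoint, adjoint_inner_left]
    have := congrArg (fun T : H →L[ℂ] ℂ => T x) this
    simpa using this.symm
  refine ⟨V, hV, hV0, fun n => key _ _ (fun m => inner_eq_of_norm_eq h n m) (fun x hx => hx n),
    fun x hx => key _ _ (fun n => ?_) (fun y _ => inner_zero_left y)⟩
  rw [inner_zero_left, ← inner_conj_symm, hx, map_zero]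

/-- If `a` and `b` are equivariant for the commutant of a von Neumann algebra, the partial isometry
of `exists_partialIsometry` belongs to the algebra. -/
theorem exists_partialIsometry_mem (M : VonNeumannAlgebra H) {N : Type*} [AddCommGroup N]
    [Module ℂ N] (a b : N →ₗ[ℂ] H) (h : ∀ n, ‖a n‖ = ‖b n‖)
    (hM : ∀ m ∈ M.commutant, ∃ φ : N → N, ∀ n, m (a n) = a (φ n) ∧ m (b n) = b (φ n)) :
    ∃ V ∈ M, (∀ n, V (a n) = b n) ∧ (∀ x, (∀ n, ⟪a n, x⟫ = 0) → V x = 0) ∧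
      (∀ n, star V (b n) = a n) ∧ (∀ x, (∀ n, ⟪b n, x⟫ = 0) → star V x = 0) := by
  obtain ⟨V, h1, h2, h3, h4⟩ := exists_partialIsometry a b h
  refine ⟨V, ?_, h1, h2, h3, h4⟩
  -- By the double commutant theorem it suffices that `V` commutes with every `m` in the commutant.
  -- Equivariance under `star m` is needed too: it makes `m` preserve the orthogonal complement of
  -- the range of `a`.
  rw [← VonNeumannAlgebra.commutant_commutant M, VonNeumannAlgebra.mem_commutant_iff]
  intro m hm
  obtain ⟨φ, hφ⟩ := hM m hm
  obtain ⟨ψ, hψ⟩ := hM (star m) (star_mem hm)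
  refine clm_ext_range_orthogonal a (fun n => ?_) (fun x hx => ?_)
  · change m (V (a n)) = V (m (a n))
    rw [h1, (hφ n).1, (hφ n).2, h1]
  · change m (V x) = V (m x)
    rw [h2 x hx, map_zero, h2]
    intro n
    rw [← adjoint_inner_left, ← star_eq_adjoint, (hψ n).1, hx]

/-- Polar decomposition in a von Neumann algebra. -/
theorem VonNeumannAlgebra.exists_polar (M : VonNeumannAlgebra H) {t : H →L[ℂ] H} (ht : t ∈ M) :
    ∃ v ∈ M, v * star v * v = v ∧ v * star v * t = t ∧ t * (star v * v) = t ∧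
      (∀ h, h * t = 0 → h * v = 0) ∧ ∀ h, t * h = 0 → v * h = 0 := by
  set s := CFC.abs t with hs
  have hss : star s = s := (CFC.abs_nonneg t).isSelfAdjoint
  have hst : star s * s = star t * t := by rw [hss]; exact CFC.abs_mul_abs t
  -- Since `s* s = t* t`, the partial isometry intertwining `s = |t|` and `t` is the polar part of
  -- `t`.
  have hnorm : ∀ x, ‖s x‖ = ‖t x‖ := by
    intro x
    have h1 : ∀ r : H →L[ℂ] H, ⟪(star r * r) x, x⟫ = ((‖r x‖ ^ 2 : ℝ) : ℂ) := by
      intro r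
      change ⟪star r (r x), x⟫ = _
      rw [star_eq_adjoint, adjoint_inner_left, inner_self_eq_norm_sq_to_K]
      push_cast
      rfl
    have h2 := h1 s
    rw [hst, h1 t] at h2
    have h3 : ‖t x‖ ^ 2 = ‖s x‖ ^ 2 := by exact_mod_cast h2
    exact ((sq_eq_sq₀ (norm_nonneg _) (norm_nonneg _)).1 h3).symm
  obtain ⟨v, hvM, h1, h2, h3, h4⟩ := exists_partialIsometry_mem M s.toLinearMap t.toLinearMap hnorm
    (by
      intro m hm
      have hmt : Commute t m := VonNeumannAlgebra.mem_commutant_iff.1 hm t ht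
      have hmt' : Commute (star t) m := VonNeumannAlgebra.mem_commutant_iff.1 hm _ (star_mem ht)
      have hmt'' : Commute t (star m) := by simpa using hmt'.star_star
      have hms : Commute m s := Commute.cfcAbs_right hmt hmt''
      exact ⟨m, fun n => ⟨congrArg (fun T : H →L[ℂ] H => T n) hms.eq,
        congrArg (fun T : H →L[ℂ] H => T n) hmt.symm.eq⟩⟩)
  have hvs : v * s = t := by ext x; exact h1 x
  have hvt : star v * t = s := by ext x; exact h3 x
  have htv : star t * v = s := by rw [← hss, ← hvt, star_mul, star_star]
  have hvv : v * star v * v = v := by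
    refine clm_ext_range_orthogonal s.toLinearMap (fun n => ?_) (fun x hx => ?_)
    · change v (star v (v (s n))) = v (s n)
      erw [h1, h3, h1]
    · change v (star v (v x)) = v x
      rw [h2 x hx, map_zero, map_zero]
  refine ⟨v, hvM, hvv, ?_, ?_, ?_, ?_⟩
  · rw [mul_assoc, hvt, hvs]
  · have hsv : s * (star v * v) = s := by
      rw [← mul_assoc, ← htv, mul_assoc (star t), mul_assoc (star t), hvv]
    rw [← hvs, mul_assoc, hsv]
  · intro h hh
    refine clm_ext_range_orthogonal s.toLinearMap (fun n => ?_) (fun x hx => ?_)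
    · change h (v (s n)) = 0
      erw [h1]
      exact congrArg (fun T : H →L[ℂ] H => T n) hh
    · change h (v x) = 0
      rw [h2 x hx, map_zero]
  · intro h hh
    ext x
    -- If `t h = 0` then `s h = 0`, so by self-adjointness of `s` the range of `h` is orthogonal to
    -- that of `s`, where `v` vanishes.
    refine h2 _ fun n => ?_
    have h5 : s (h x) = 0 := by
      rw [← norm_eq_zero, hnorm]
      exact norm_eq_zero.2 (congrArg (fun T : H →L[ℂ] H => T x) hh)
    change ⟪s n, h x⟫ = 0
    rw [← hss, star_eq_adjoint, adjoint_inner_left, h5, inner_zero_right]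

/-- Sums of orthogonal families of partial isometries exist in a von Neumann algebra. -/
theorem VonNeumannAlgebra.exists_sum_partialIsometry (M : VonNeumannAlgebra H) {K : Type*}
    (u : K → H →L[ℂ] H) (hu : ∀ k, u k ∈ M) (hpi : ∀ k, u k * star (u k) * u k = u k)
    (hl : ∀ k l, k ≠ l → star (u k) * u l = 0) (hr : ∀ k l, k ≠ l → u k * star (u l) = 0) :
    ∃ v ∈ M, v * star v * v = v ∧ (∀ k, v * (star (u k) * u k) = u k) ∧
      (∀ k, star v * v * (star (u k) * u k) = star (u k) * u k) ∧
      (∀ h, (∀ k, h * u k = 0) → h * v = 0) ∧ ∀ h, (∀ k, u k * h = 0) → v * h = 0 := by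
  classical
  -- The maps are `(x_k) ↦ ∑ u_k* x_k` and `(x_k) ↦ ∑ u_k u_k* x_k`, so the intertwiner acts as
  -- `u_k` on the initial space of each `u_k`. Working with finite supports avoids any convergence
  -- question.
  let a : (K →₀ H) →ₗ[ℂ] H := Finsupp.lsum ℂ fun k => (star (u k)).toLinearMap
  let b : (K →₀ H) →ₗ[ℂ] H := Finsupp.lsum ℂ fun k => (u k * star (u k)).toLinearMap
  have ha : ∀ n : K →₀ H, a n = n.sum fun k x => star (u k) x := fun n => rfl
  have hb : ∀ n : K →₀ H, b n = n.sum fun k x => (u k * star (u k)) x := fun n => rfl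
  have has : ∀ k x, a (Finsupp.single k x) = star (u k) x := fun k x => by
    exact (ha _).trans (Finsupp.sum_single_index (map_zero _))
  have hbs : ∀ k x, b (Finsupp.single k x) = u k (star (u k) x) := fun k x => by
    exact (hb _).trans (Finsupp.sum_single_index (map_zero _))
  have hinner : ∀ k l x y, ⟪star (u k) x, star (u l) y⟫ =
      ⟪(u k * star (u k)) x, (u l * star (u l)) y⟫ := by
    intro k l x y
    have h1 : star (u k * star (u k)) * (u l * star (u l)) = u k * star (u l) := by
      rw [star_mul, star_star]
      by_cases hkl : k = l
      · subst hkl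
        rw [← mul_assoc, hpi]
      · rw [hr k l hkl, ← mul_assoc, mul_assoc (u k), hl k l hkl, mul_zero, zero_mul]
    rw [← adjoint_inner_right, ← adjoint_inner_right, ← star_eq_adjoint, ← star_eq_adjoint,
      star_star]
    exact congrArg (fun T : H →L[ℂ] H => ⟪x, T y⟫) h1.symm
  have hnorm : ∀ n, ‖a n‖ = ‖b n‖ := by
    intro n
    have h1 : ⟪a n, a n⟫ = ⟪b n, b n⟫ := by
      rw [ha, hb]
      simp only [Finsupp.sum, sum_inner, inner_sum, hinner]
    rw [inner_self_eq_norm_sq_to_K, inner_self_eq_norm_sq_to_K] at h1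
    have h3 : ‖a n‖ ^ 2 = ‖b n‖ ^ 2 := by exact_mod_cast h1
    exact (sq_eq_sq₀ (norm_nonneg _) (norm_nonneg _)).1 h3
  obtain ⟨v, hvM, h1, h2, h3, h4⟩ := exists_partialIsometry_mem M a b hnorm
    (by
      intro m hm
      have hmu : ∀ k, u k * m = m * u k := fun k =>
        VonNeumannAlgebra.mem_commutant_iff.1 hm _ (hu k)
      have hmu' : ∀ k, star (u k) * m = m * star (u k) := fun k =>
        VonNeumannAlgebra.mem_commutant_iff.1 hm _ (star_mem (hu k))
      refine ⟨Finsupp.mapRange m (map_zero m), fun n => ?_⟩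
      induction n using Finsupp.induction_linear with
      | zero => simp
      | add f g hf hg =>
        rw [Finsupp.mapRange_add (map_add m)]
        simp only [map_add, hf.1, hf.2, hg.1, hg.2, and_self]
      | single k x =>
        rw [Finsupp.mapRange_single, has, has, hbs, hbs]
        have e1 : ∀ y, star (u k) (m y) = m (star (u k) y) := fun y =>
          congrArg (fun T : H →L[ℂ] H => T y) (hmu' k)
        have e2 : ∀ y, u k (m y) = m (u k y) := fun y =>
          congrArg (fun T : H →L[ℂ] H => T y) (hmu k)
        rw [e1, e2]
        exact ⟨rfl, rfl⟩)
  have e1 : ∀ k, v * star (u k) = u k * star (u k) := fun k => by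
    ext x
    have := h1 (Finsupp.single k x)
    rwa [has, hbs] at this
  have e2 : ∀ k, star v * (u k * star (u k)) = star (u k) := fun k => by
    ext x
    have := h3 (Finsupp.single k x)
    rwa [has, hbs] at this
  have e3 : ∀ k, v * (star (u k) * u k) = u k := fun k => by rw [← mul_assoc, e1, hpi]
  refine ⟨v, hvM, ?_, e3, fun k => ?_, fun h hh => ?_, fun h hh => ?_⟩
  · refine clm_ext_range_orthogonal a (fun n => ?_) (fun x hx => ?_)
    · change v (star v (v (a n))) = v (a n)
      rw [h1, h3, h1]
    · change v (star v (v x)) = v x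
      rw [h2 x hx, map_zero, map_zero]
  · rw [mul_assoc, e3]
    conv_lhs => rw [← hpi k, ← mul_assoc, e2]
  · refine clm_ext_range_orthogonal a (fun n => ?_) (fun x hx => ?_)
    · change h (v (a n)) = 0
      rw [h1, hb, Finsupp.sum, map_sum]
      refine Finset.sum_eq_zero fun k _ => ?_
      exact congrArg (fun T : H →L[ℂ] H => T (star (u k) (n k))) (hh k)
    · change h (v x) = 0
      rw [h2 x hx, map_zero]
  · ext x
    refine h2 _ fun n => ?_
    rw [ha, Finsupp.sum, sum_inner]
    refine Finset.sum_eq_zero fun k _ => ?_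
    rw [star_eq_adjoint, adjoint_inner_left]
    have : u k (h x) = 0 := congrArg (fun T : H →L[ℂ] H => T x) (hh k)
    exact (congrArg _ this).trans (inner_zero_right _)

end Operators

/-! ### Transfer to abstract W*-algebras. -/

section WStarAlgebra

variable {A : Type v} [Ring A] [StarRing A] [Algebra ℂ A]

/-- Polar decomposition in a W*-algebra. -/
theorem IsWStarAlgebra.exists_polar (hA : IsWStarAlgebra A) (t : A) :
    ∃ v : A, v * star v * v = v ∧ v * star v * t = t ∧ t * (star v * v) = t ∧
      (∀ h, h * t = 0 → h * v = 0) ∧ ∀ h, t * h = 0 → v * h = 0 := by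
  obtain ⟨H, _, _, _, M, ⟨φ⟩⟩ := hA
  have hφ : ∀ a, (φ (star a) : H →L[ℂ] H) = star (φ a : H →L[ℂ] H) := fun a => by
    rw [map_star]; rfl
  obtain ⟨v, hv, h1, h2, h3, h4, h5⟩ := VonNeumannAlgebra.exists_polar M (φ t).2
  obtain ⟨w, hw⟩ := φ.surjective ⟨v, hv⟩
  have hwv : (φ w : H →L[ℂ] H) = v := congrArg Subtype.val hw
  have inj : Function.Injective fun a => (φ a : H →L[ℂ] H) :=
    Subtype.val_injective.comp φ.injective
  refine ⟨w, inj ?_, inj ?_, inj ?_, fun h hh => inj ?_, fun h hh => inj ?_⟩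
  · simpa [hφ, hwv] using h1
  · simpa [hφ, hwv] using h2
  · simpa [hφ, hwv] using h3
  · simpa [hφ, hwv] using h4 (φ h) (by simpa [hφ] using congrArg (fun a => (φ a : H →L[ℂ] H)) hh)
  · simpa [hφ, hwv] using h5 (φ h) (by simpa [hφ] using congrArg (fun a => (φ a : H →L[ℂ] H)) hh)

/-- Sums of orthogonal families of partial isometries exist in a W*-algebra. -/
theorem IsWStarAlgebra.exists_sum_partialIsometry (hA : IsWStarAlgebra A) {K : Type*}
    (u : K → A) (hpi : ∀ k, u k * star (u k) * u k = u k)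
    (hl : ∀ k l, k ≠ l → star (u k) * u l = 0) (hr : ∀ k l, k ≠ l → u k * star (u l) = 0) :
    ∃ v : A, v * star v * v = v ∧ (∀ k, v * (star (u k) * u k) = u k) ∧
      (∀ k, star v * v * (star (u k) * u k) = star (u k) * u k) ∧
      (∀ h, (∀ k, h * u k = 0) → h * v = 0) ∧ ∀ h, (∀ k, u k * h = 0) → v * h = 0 := by
  obtain ⟨H, _, _, _, M, ⟨φ⟩⟩ := hA
  have hφ : ∀ a, (φ (star a) : H →L[ℂ] H) = star (φ a : H →L[ℂ] H) := fun a => by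
    rw [map_star]; rfl
  have tr : ∀ {a b : A}, a = b → (φ a : H →L[ℂ] H) = φ b := fun h => by rw [h]
  obtain ⟨v, hv, h1, h2, h3, h4, h5⟩ := VonNeumannAlgebra.exists_sum_partialIsometry M
    (fun k => (φ (u k) : H →L[ℂ] H)) (fun k => (φ (u k)).2)
    (fun k => by simpa [hφ] using tr (hpi k)) (fun k l h => by simpa [hφ] using tr (hl k l h))
    (fun k l h => by simpa [hφ] using tr (hr k l h))
  obtain ⟨w, hw⟩ := φ.surjective ⟨v, hv⟩
  have hwv : (φ w : H →L[ℂ] H) = v := congrArg Subtype.val hw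
  have inj : Function.Injective fun a => (φ a : H →L[ℂ] H) :=
    Subtype.val_injective.comp φ.injective
  refine ⟨w, inj ?_, fun k => inj ?_, fun k => inj ?_, fun h hh => inj ?_, fun h hh => inj ?_⟩
  · simpa [hφ, hwv] using h1
  · simpa [hφ, hwv] using h2 k
  · simpa [hφ, hwv] using h3 k
  · simpa [hφ, hwv] using h4 (φ h) (fun k => by simpa [hφ] using tr (hh k))
  · simpa [hφ, hwv] using h5 (φ h) (fun k => by simpa [hφ] using tr (hh k))

end WStarAlgebra

/-! ### Two-by-two matrices of morphisms. -/

section Matrices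

variable {C : Type u} [Category.{v} C] [Preadditive C]

/-- The formal direct sum of two objects. -/
def formalSum (x y : C) : Mat_ C where
  ι := Bool
  X := fun | false => x | true => y

/-- An endomorphism of a formal direct sum of two objects from its four entries. -/
def blockMatrix {x y : C} (a : x ⟶ x) (b : x ⟶ y) (c : y ⟶ x) (d : y ⟶ y) :
    End (formalSum x y) :=
  fun | false, false => a | false, true => b | true, false => c | true, true => d

theorem exists_eq_blockMatrix {x y : C} (m : End (formalSum x y)) :
    ∃ a b c d, m = blockMatrix a b c d := by
  refine ⟨m false false, m false true, m true false, m true true, ?_⟩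
  refine Mat_.hom_ext _ _ ?_
  rintro (_ | _) (_ | _) <;> rfl

theorem blockMatrix_inj {x y : C} {a a' : x ⟶ x} {b b' : x ⟶ y} {c c' : y ⟶ x} {d d' : y ⟶ y} :
    blockMatrix a b c d = blockMatrix a' b' c' d' ↔ a = a' ∧ b = b' ∧ c = c' ∧ d = d' := by
  constructor
  · intro h
    exact ⟨congrFun (congrFun h false) false, congrFun (congrFun h false) true,
      congrFun (congrFun h true) false, congrFun (congrFun h true) true⟩
  · rintro ⟨rfl, rfl, rfl, rfl⟩
    rfl

theorem blockMatrix_mul {x y : C} (a a' : x ⟶ x) (b b' : x ⟶ y) (c c' : y ⟶ x) (d d' : y ⟶ y) :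
    blockMatrix a b c d * blockMatrix a' b' c' d' =
      blockMatrix (a' ≫ a + b' ≫ c) (a' ≫ b + b' ≫ d) (c' ≫ a + d' ≫ c) (c' ≫ b + d' ≫ d) := by
  refine Mat_.hom_ext _ _ ?_
  rintro (_ | _) (_ | _) <;>
  · refine (Mat_.comp_apply (blockMatrix a' b' c' d') (blockMatrix a b c d) _ _).trans ?_
    -- `Fintype.sum_bool` lists the `true` term first, hence the swap.
    exact (Fintype.sum_bool _).trans (add_comm _ _)

theorem blockMatrix_zero (x y : C) : (0 : End (formalSum x y)) = blockMatrix 0 0 0 0 := by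
  refine Mat_.hom_ext _ _ ?_
  rintro (_ | _) (_ | _) <;> rfl

theorem star_blockMatrix [Linear ℂ C] [StarCategory C] {x y : C} (a : x ⟶ x) (b : x ⟶ y)
    (c : y ⟶ x) (d : y ⟶ y) :
    star (blockMatrix a b c d) = blockMatrix (adj a) (adj c) (adj b) (adj d) := by
  refine Mat_.hom_ext _ _ ?_
  rintro (_ | _) (_ | _) <;> rfl

end Matrices

/-! ### Polar decomposition and orthogonal sums for morphisms. -/

section Decompositions

variable {C : Type u} [Category.{v} C] [Preadditive C] [Linear ℂ C] [StarCategory C]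

/-- Polar decomposition in a W*-category. -/
theorem IsWStarCategory.exists_polar (hC : IsWStarCategory C) {x y : C} (f : x ⟶ y) :
    ∃ v : x ⟶ y, v ≫ adj v ≫ v = v ∧ f ≫ adj v ≫ v = f ∧ (v ≫ adj v) ≫ f = f ∧
      (∀ h : y ⟶ y, f ≫ h = 0 → v ≫ h = 0) ∧ ∀ h : x ⟶ x, h ≫ f = 0 → h ≫ v = 0 := by
  obtain ⟨w, h1, h2, h3, h4, h5⟩ :=
    (hC (formalSum x y)).exists_polar (blockMatrix (0 : x ⟶ x) f 0 0)
  obtain ⟨a, v, c, d, rfl⟩ := exists_eq_blockMatrix w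
  -- The annihilation clauses, tested on the two diagonal projections, kill every entry of the polar
  -- part except the one `x ⟶ y`.
  have ha := h4 (blockMatrix (𝟙 x) 0 0 0)
  have hc := h5 (blockMatrix 0 0 0 (𝟙 y))
  simp only [blockMatrix_mul, blockMatrix_zero, blockMatrix_inj, adj_zero, Limits.comp_zero,
    Limits.zero_comp, add_zero, zero_add, Category.comp_id, Category.id_comp, and_true, true_and,
    star_blockMatrix, forall_const] at *
  obtain ⟨rfl, rfl⟩ := ha
  obtain ⟨-, rfl⟩ := hc
  simp only [adj_zero, Limits.comp_zero, Limits.zero_comp, add_zero, zero_add, and_true,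
    true_and] at *
  refine ⟨v, h1, h2, h3, fun h hh => ?_, fun h hh => ?_⟩
  · have := h4 (blockMatrix 0 0 0 h)
    simp only [blockMatrix_mul, blockMatrix_inj, Limits.comp_zero, Limits.zero_comp, add_zero,
      zero_add, and_true, true_and] at this
    exact this hh
  · have := h5 (blockMatrix h 0 0 0)
    simp only [blockMatrix_mul, blockMatrix_inj, Limits.comp_zero, Limits.zero_comp, add_zero,
      zero_add, and_true, true_and] at this
    exact this hh

/-- Sums of orthogonal families of partial isometries exist in a W*-category. -/
theorem IsWStarCategory.exists_sum_partialIsometry (hC : IsWStarCategory C) {x y : C} {K : Type*}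
    (u : K → (x ⟶ y)) (hpi : ∀ k, u k ≫ adj (u k) ≫ u k = u k)
    (hl : ∀ k l, k ≠ l → u l ≫ adj (u k) = 0) (hr : ∀ k l, k ≠ l → adj (u l) ≫ u k = 0) :
    ∃ v : x ⟶ y, v ≫ adj v ≫ v = v ∧ (∀ k, (u k ≫ adj (u k)) ≫ v = u k) ∧
      (∀ k, (u k ≫ adj (u k)) ≫ v ≫ adj v = u k ≫ adj (u k)) ∧
      (∀ h : y ⟶ y, (∀ k, u k ≫ h = 0) → v ≫ h = 0) ∧
      ∀ h : x ⟶ x, (∀ k, h ≫ u k = 0) → h ≫ v = 0 := by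
  obtain ⟨w, h1, h2, h3, h4, h5⟩ :=
    (hC (formalSum x y)).exists_sum_partialIsometry
      (fun k => blockMatrix (0 : x ⟶ x) (u k) 0 0)
      (fun k => by
        simp only [blockMatrix_mul, star_blockMatrix, adj_zero, Limits.comp_zero,
          Limits.zero_comp, add_zero, zero_add, hpi])
      (fun k l h => by
        simp only [blockMatrix_mul, star_blockMatrix, adj_zero, Limits.comp_zero,
          Limits.zero_comp, add_zero, zero_add, hl k l h, blockMatrix_zero])
      (fun k l h => by
        simp only [blockMatrix_mul, star_blockMatrix, adj_zero, Limits.comp_zero,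
          Limits.zero_comp, add_zero, zero_add, hr k l h, blockMatrix_zero])
  obtain ⟨a, v, c, d, rfl⟩ := exists_eq_blockMatrix w
  -- As for the polar part, the diagonal projections force the sum to be off-diagonal.
  have ha := h4 (blockMatrix (𝟙 x) 0 0 0)
  have hc := h5 (blockMatrix 0 0 0 (𝟙 y))
  simp only [blockMatrix_mul, blockMatrix_zero, blockMatrix_inj, adj_zero, Limits.comp_zero,
    Limits.zero_comp, add_zero, zero_add, Category.comp_id, Category.id_comp, and_true, true_and,
    star_blockMatrix, forall_const] at *
  obtain ⟨rfl, rfl⟩ := ha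
  obtain ⟨-, rfl⟩ := hc
  simp only [adj_zero, Limits.comp_zero, Limits.zero_comp, add_zero, zero_add, and_true,
    true_and] at *
  refine ⟨v, h1, h2, h3, fun h hh => ?_, fun h hh => ?_⟩
  · have := h4 (blockMatrix 0 0 0 h)
    simp only [blockMatrix_mul, blockMatrix_inj, Limits.comp_zero, Limits.zero_comp, add_zero,
      zero_add, and_true, true_and] at this
    exact this hh
  · have := h5 (blockMatrix h 0 0 0)
    simp only [blockMatrix_mul, blockMatrix_inj, Limits.comp_zero, Limits.zero_comp, add_zero,
      zero_add, and_true, true_and] at this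
    exact this hh

/-- The C*-property `f* f = 0 → f = 0` in a W*-category. -/
theorem IsWStarCategory.eq_zero_of_comp_adj (hC : IsWStarCategory C) {x y : C} {f : x ⟶ y}
    (h : f ≫ adj f = 0) : f = 0 := by
  obtain ⟨v, -, h2, h3, h4, -⟩ := hC.exists_polar f
  -- No norm is at hand, so the polar part replaces it: `f ≫ adj f = 0` passes to `v ≫ adj f = 0`
  -- after multiplying by `v`, and the support relations then give `f = 0`.
  have h5 : v ≫ adj f ≫ v = 0 :=
    h4 (adj f ≫ v) (by rw [← Category.assoc, h, Limits.zero_comp])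
  have h6 : adj v ≫ f ≫ adj v = 0 := by
    have := congrArg adj h5
    rwa [adj_zero, StarCategory.adj_comp, StarCategory.adj_comp, StarCategory.adj_adj,
      Category.assoc] at this
  have h7 : adj v ≫ f = 0 := by
    rw [← h2]
    calc adj v ≫ f ≫ adj v ≫ v = (adj v ≫ f ≫ adj v) ≫ v := by simp only [Category.assoc]
      _ = 0 := by rw [h6, Limits.zero_comp]
  rw [← h3, Category.assoc, h7, Limits.comp_zero]

end Decompositions

/-! ### Bounding orthogonal families by separability. -/

section Cardinality

/-- By Bessel's inequality each basis vector is non-orthogonal to only countably many `e k`, and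
every `e k`, being non-zero, is non-orthogonal to some basis vector. -/
theorem mk_le_of_orthonormal {H : Type v} [NormedAddCommGroup H] [InnerProductSpace ℂ H]
    {I K : Type v} (b : HilbertBasis I ℂ H) {e : K → H} (he : Orthonormal ℂ e) :
    Cardinal.mk K ≤ Cardinal.mk I * Cardinal.aleph0 := by
  let S : I → Set K := fun i => {k | inner ℂ (e k) (b i) ≠ 0}
  have hS : ∀ i, Cardinal.mk (S i) ≤ Cardinal.aleph0 := by
    intro i
    rw [Cardinal.mk_le_aleph0_iff, Set.countable_coe_iff]
    refine (he.inner_products_summable (b i)).countable_support.mono fun k hk => ?_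
    exact pow_ne_zero 2 (norm_ne_zero_iff.2 hk)
  have hU : (⋃ i, S i) = Set.univ := by
    refine Set.eq_univ_of_forall fun k => ?_
    by_contra hk
    have h0 : ∀ i, inner ℂ (e k) (b i) = 0 := by
      intro i
      by_contra h
      exact hk (Set.mem_iUnion.2 ⟨i, h⟩)
    have : e k = 0 := by
      refine b.repr.injective ?_
      ext i
      rw [b.repr_apply_apply, ← inner_conj_symm, h0, map_zero]
      simp
    exact he.ne_zero k this
  calc Cardinal.mk K = Cardinal.mk (⋃ i, S i) := by rw [hU, Cardinal.mk_univ]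
    _ ≤ Cardinal.sum fun i => Cardinal.mk (S i) := Cardinal.mk_iUnion_le_sum_mk
    _ ≤ Cardinal.sum fun _ : I => Cardinal.aleph0 := Cardinal.sum_le_sum _ _ hS
    _ = Cardinal.mk I * Cardinal.aleph0 := Cardinal.sum_const' _ _

/-- A family of non-zero pairwise orthogonal projections in an `ℵ_{α+1}`-separable algebra has at
most `ℵ_α` members. -/
theorem IsKappaSeparable.mk_le {A : Type v} [Ring A] [StarRing A] [Algebra ℂ A] {α : Ordinal.{v}}
    (hA : IsKappaSeparable (Cardinal.aleph (α + 1)) A) {K : Type v} (e : K → A)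
    (h0 : ∀ k, e k ≠ 0) (hs : ∀ k, star (e k) = e k)
    (ho : ∀ k l, k ≠ l → e k * e l = 0) : Cardinal.mk K ≤ Cardinal.aleph α := by
  obtain ⟨-, H, _, _, _, π, ⟨I, hI, ⟨b⟩⟩, hπ, -⟩ := hA
  have h1 : ∀ k, ∃ x : H, π (e k) x ≠ 0 := by
    intro k
    by_contra! h
    exact h0 k (hπ (by rw [map_zero]; ext x; exact h x))
  choose x hx using h1
  -- One unit vector in the range of each projection; orthogonality of the ranges makes the family
  -- orthonormal.
  let f : K → H := fun k => ((‖π (e k) (x k)‖⁻¹ : ℝ) : ℂ) • π (e k) (x k)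
  have hf : Orthonormal ℂ f := by
    refine ⟨fun k => ?_, fun k l hkl => ?_⟩
    · simp only [f, norm_smul, Complex.norm_real, norm_inv, norm_norm]
      exact inv_mul_cancel₀ (norm_ne_zero_iff.2 (hx k))
    · have : inner ℂ (π (e k) (x k)) (π (e l) (x l)) = 0 := by
        rw [← hs k, map_star, ContinuousLinearMap.star_eq_adjoint,
          ContinuousLinearMap.adjoint_inner_left]
        have h2 : π (e k) * π (e l) = 0 := by rw [← map_mul, ho k l hkl, map_zero]
        have h3 : π (e k) (π (e l) (x l)) = 0 := congrArg (fun T : H →L[ℂ] H => T (x l)) h2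
        rw [h3, inner_zero_right]
      simp only [f]
      rw [inner_smul_left, inner_smul_right, this, mul_zero, mul_zero]
  -- This is where `κ` must be a successor: a basis of size `< ℵ_{α+1}` has size at most `ℵ_α`, and
  -- the factor `ℵ₀` is absorbed.
  have hI' : Cardinal.mk I ≤ Cardinal.aleph α := by
    rwa [← Cardinal.succ_aleph, Order.lt_succ_iff] at hI
  exact (mk_le_of_orthonormal b hf).trans (Cardinal.mul_le_of_le (Cardinal.aleph0_le_aleph α) hI'
    (Cardinal.aleph0_le_aleph α))

end Cardinality

/-! ### Schröder–Bernstein and embedding into a large direct sum. -/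

section Comparison

variable {C : Type u} [Category.{v} C] [Preadditive C] [Linear ℂ C] [StarCategory C]

theorem adj_neg {x y : C} (f : x ⟶ y) : adj (-f) = -adj f := by
  have h := StarCategory.adj_add f (-f)
  rw [add_neg_cancel, adj_zero] at h
  exact (neg_eq_of_add_eq_zero_right h.symm).symm

theorem adj_sub {x y : C} (f g : x ⟶ y) : adj (f - g) = adj f - adj g := by
  rw [sub_eq_add_neg, StarCategory.adj_add, adj_neg, ← sub_eq_add_neg]

theorem adj_id (x : C) : adj (𝟙 x) = 𝟙 x := (IdemCompletion.of x).selfAdj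

/-- For an isometry `s` and a projection `p` orthogonal to its range there is a projection `e`
with `e = p + s e s*`. -/
theorem IsWStarCategory.exists_projection_eq_add (hC : IsWStarCategory C) {x : C} {s p : x ⟶ x}
    (hs : s ≫ adj s = 𝟙 x) (hp : p ≫ p = p) (hp' : adj p = p) (hsp : s ≫ p = 0) :
    ∃ e : x ⟶ x, e ≫ e = e ∧ adj e = e ∧ e ≫ p = p ∧ e = p + adj s ≫ e ≫ s ∧
      e ≫ s ≫ e = e ≫ s := by
  have hps : p ≫ adj s = 0 := by
    have := congrArg adj hsp
    rwa [StarCategory.adj_comp, hp', adj_zero] at this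
  -- In operator notation `q n = sⁿ p (s*)ⁿ`. These projections are mutually orthogonal and
  -- conjugation by `s` shifts them, so `e` is taken to be their sum.
  let q : ℕ → (x ⟶ x) := fun n => Nat.rec p (fun _ r => adj s ≫ r ≫ s) n
  have q0 : q 0 = p := rfl
  have qs : ∀ n, q (n + 1) = adj s ≫ q n ≫ s := fun n => rfl
  have hq' : ∀ n, adj (q n) = q n := by
    intro n
    induction n with
    | zero => exact hp'
    | succ n ih => simp only [qs, StarCategory.adj_comp, StarCategory.adj_adj, ih, Category.assoc]
  have hmul : ∀ m n, q (m + 1) ≫ q (n + 1) = adj s ≫ (q m ≫ q n) ≫ s := by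
    intro m n
    calc q (m + 1) ≫ q (n + 1) = adj s ≫ q m ≫ (s ≫ adj s) ≫ q n ≫ s := by
          simp only [qs, Category.assoc]
      _ = _ := by simp only [hs, Category.id_comp, Category.assoc]
  have hq : ∀ n, q n ≫ q n = q n := by
    intro n
    induction n with
    | zero => exact hp
    | succ n ih => rw [hmul, ih, qs]
  have hqo : ∀ m n, m ≠ n → q m ≫ q n = 0 := by
    intro m
    induction m with
    | zero =>
      intro n hn
      obtain ⟨n, rfl⟩ := Nat.exists_eq_succ_of_ne_zero hn.symm
      rw [Nat.succ_eq_add_one, qs, q0, ← Category.assoc, hps, Limits.zero_comp]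
    | succ m ih =>
      intro n hn
      cases n with
      | zero => rw [qs, q0, Category.assoc, Category.assoc, hsp, Limits.comp_zero, Limits.comp_zero]
      | succ n =>
        rw [hmul, ih n (fun h => hn (by rw [h])), Limits.zero_comp, Limits.comp_zero]
  obtain ⟨w, hw, -, h2, -, h4⟩ := hC.exists_sum_partialIsometry q
    (fun n => by rw [hq', hq, hq]) (fun m n h => by rw [hq', hqo _ _ h.symm])
    (fun m n h => by rw [hq', hqo _ _ h.symm])
  simp only [hq', hq] at h2
  set e := w ≫ adj w with he
  have he' : adj e = e := by rw [he, StarCategory.adj_comp, StarCategory.adj_adj]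
  have hee : e ≫ e = e := by
    calc e ≫ e = (w ≫ adj w ≫ w) ≫ adj w := by simp only [he, Category.assoc]
      _ = e := by rw [hw]
  have hle : ∀ n, e ≫ q n = q n := by
    intro n
    have := congrArg adj (h2 n)
    rwa [StarCategory.adj_comp, hq', he'] at this
  -- Minimality of `e` above the `q n`. It replaces passage to the limit: an identity involving `e`
  -- need only be checked against each `q n`.
  have hmin : ∀ h : x ⟶ x, (∀ n, h ≫ q n = 0) → h ≫ e = 0 := by
    intro h hh
    rw [he, ← Category.assoc, h4 h hh, Limits.zero_comp]
  have hinv : adj s ≫ e = e ≫ adj s ≫ e := by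
    have := hmin (adj s - e ≫ adj s) (fun n => by
      have h5 : adj s ≫ q n = q (n + 1) ≫ adj s := by
        rw [qs, Category.assoc, Category.assoc, hs, Category.comp_id]
      rw [Preadditive.sub_comp, Category.assoc, h5, ← Category.assoc e, hle (n + 1), sub_self])
    rwa [Preadditive.sub_comp, Category.assoc, sub_eq_zero] at this
  have hinv' : e ≫ s ≫ e = e ≫ s := by
    have := congrArg adj hinv
    simpa only [StarCategory.adj_comp, StarCategory.adj_adj, he', Category.assoc] using this.symm
  refine ⟨e, hee, he', hle 0, ?_, hinv'⟩
  have h6 : e = (p + adj s ≫ e ≫ s) ≫ e := by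
    have := hmin (𝟙 x - (p + adj s ≫ e ≫ s)) (fun n => by
      cases n with
      | zero =>
        simp only [q0, Preadditive.sub_comp, Preadditive.add_comp, Category.assoc, hsp, hp,
          Category.id_comp, Limits.comp_zero, add_zero, sub_self]
      | succ n =>
        have h7 : p ≫ q (n + 1) = 0 := hqo 0 (n + 1) (Nat.succ_ne_zero n).symm
        have h8 : (adj s ≫ e ≫ s) ≫ q (n + 1) = q (n + 1) := by
          calc (adj s ≫ e ≫ s) ≫ q (n + 1) = adj s ≫ e ≫ (s ≫ adj s) ≫ q n ≫ s := by
                simp only [qs, Category.assoc]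
            _ = adj s ≫ (e ≫ q n) ≫ s := by simp only [hs, Category.id_comp, Category.assoc]
            _ = q (n + 1) := by rw [hle, qs]
        rw [Preadditive.sub_comp, Preadditive.add_comp, h7, h8, zero_add, Category.id_comp,
          sub_self])
    rwa [Preadditive.sub_comp, Category.id_comp, sub_eq_zero] at this
  have h9 : p ≫ e = p := h2 0
  rw [Preadditive.add_comp, h9, Category.assoc, Category.assoc, hinv'] at h6
  exact h6

/-- Schröder–Bernstein: objects embedding isometrically into each other are unitarily
isomorphic. -/
theorem IsWStarCategory.exists_unitaryIso (hC : IsWStarCategory C) {x y : C} {u : x ⟶ y}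
    {v : y ⟶ x} (hu : IsIsometry u) (hv : IsIsometry v) : ∃ e : x ≅ y, IsUnitaryIso e := by
  change u ≫ adj u = 𝟙 x at hu
  change v ≫ adj v = 𝟙 y at hv
  -- Cantor's decomposition: `e` is the sum of the images of `1 - v v*` under the powers of `v u`.
  -- The unitary will be `u` on `e` and `v*` on `f = 1 - e`, which lies under `v v*`.
  obtain ⟨e, hee, he', hep, hes, hinv⟩ := hC.exists_projection_eq_add (s := u ≫ v)
    (p := 𝟙 x - adj v ≫ v)
    (by
      calc (u ≫ v) ≫ adj (u ≫ v) = u ≫ (v ≫ adj v) ≫ adj u := by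
            simp only [StarCategory.adj_comp, Category.assoc]
        _ = 𝟙 x := by rw [hv, Category.id_comp, hu])
    (by
      have : (adj v ≫ v) ≫ adj v ≫ v = adj v ≫ v := by
        calc (adj v ≫ v) ≫ adj v ≫ v = adj v ≫ (v ≫ adj v) ≫ v := by
              simp only [Category.assoc]
          _ = _ := by rw [hv, Category.id_comp]
      simp only [Preadditive.sub_comp, Preadditive.comp_sub, Category.id_comp, Category.comp_id,
        this, sub_self, sub_zero])
    (by rw [adj_sub, adj_id, StarCategory.adj_comp, StarCategory.adj_adj])
    (by
      rw [Preadditive.comp_sub, Category.comp_id, Category.assoc, ← Category.assoc v, hv,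
        Category.id_comp, sub_self])
  obtain ⟨f, hf⟩ : ∃ f : x ⟶ x, f = 𝟙 x - e := ⟨_, rfl⟩
  have hef : e ≫ f = 0 := by rw [hf, Preadditive.comp_sub, Category.comp_id, hee, sub_self]
  have hfe : f ≫ e = 0 := by rw [hf, Preadditive.sub_comp, Category.id_comp, hee, sub_self]
  have hf' : adj f = f := by rw [hf, adj_sub, adj_id, he']
  have hff : f ≫ f = f := by
    conv_lhs => rw [hf, Preadditive.sub_comp, Category.id_comp, ← hf, hef, sub_zero]
  have hsum : e + f = 𝟙 x := by rw [hf, add_sub_cancel]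
  have hfv : f ≫ adj v ≫ v = f := by
    have h1 : f ≫ (𝟙 x - adj v ≫ v) = 0 := by
      rw [hf, Preadditive.sub_comp, Category.id_comp, hep, sub_self]
    rw [Preadditive.comp_sub, Category.comp_id, sub_eq_zero] at h1
    exact h1.symm
  have hsf : e ≫ u ≫ v ≫ f = 0 := by
    have h1 : e ≫ u ≫ v ≫ e = e ≫ u ≫ v := by simpa only [Category.assoc] using hinv
    rw [hf]
    simp only [Preadditive.comp_sub, Category.comp_id, h1, sub_self]
  have hsf' : f ≫ adj v ≫ adj u ≫ e = 0 := by
    have := congrArg adj hsf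
    simpa only [StarCategory.adj_comp, hf', he', adj_zero, Category.assoc] using this
  have hvp : v ≫ (𝟙 x - adj v ≫ v) = 0 := by
    rw [Preadditive.comp_sub, Category.comp_id, ← Category.assoc, hv, Category.id_comp, sub_self]
  -- In operator notation `v* e v = u e u*`, so the image of `e` under `u` and that of `f` under
  -- `v*` are complementary in `y`.
  have hve : v ≫ e ≫ adj v = adj u ≫ e ≫ u := by
    calc v ≫ e ≫ adj v = v ≫ (𝟙 x - adj v ≫ v + adj (u ≫ v) ≫ e ≫ u ≫ v) ≫ adj v := by
          rw [← hes]
      _ = (v ≫ (𝟙 x - adj v ≫ v)) ≫ adj v + (v ≫ adj v) ≫ (adj u ≫ e ≫ u) ≫ v ≫ adj v := by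
          simp only [Preadditive.add_comp, Preadditive.comp_add, StarCategory.adj_comp,
            Category.assoc]
      _ = _ := by rw [hvp, hv, Limits.zero_comp, zero_add, Category.id_comp, Category.comp_id]
  have hadj : adj (e ≫ u + f ≫ adj v) = adj u ≫ e + v ≫ f := by
    simp only [StarCategory.adj_add, StarCategory.adj_comp, StarCategory.adj_adj, he', hf']
  refine ⟨⟨e ≫ u + f ≫ adj v, adj u ≫ e + v ≫ f, ?_, ?_⟩, hadj.symm⟩
  · calc (e ≫ u + f ≫ adj v) ≫ (adj u ≫ e + v ≫ f)
        = e ≫ (u ≫ adj u) ≫ e + f ≫ adj v ≫ adj u ≫ e + (e ≫ u ≫ v ≫ f + (f ≫ adj v ≫ v) ≫ f) := by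
          simp only [Preadditive.add_comp, Preadditive.comp_add, Category.assoc]
      _ = _ := by rw [hu, hsf, hsf', hfv, hff, Category.id_comp, hee, add_zero, zero_add, hsum]
  · calc (adj u ≫ e + v ≫ f) ≫ (e ≫ u + f ≫ adj v)
        = adj u ≫ (e ≫ e) ≫ u + v ≫ (f ≫ e) ≫ u +
            (adj u ≫ (e ≫ f) ≫ adj v + v ≫ (f ≫ f) ≫ adj v) := by
          simp only [Preadditive.add_comp, Preadditive.comp_add, Category.assoc]
      _ = v ≫ e ≫ adj v + v ≫ f ≫ adj v := by
          rw [hee, hfe, hef, hff, hve]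
          simp only [Limits.zero_comp, Limits.comp_zero, add_zero, zero_add]
      _ = v ≫ (e + f) ≫ adj v := by simp only [Preadditive.add_comp, Preadditive.comp_add]
      _ = 𝟙 y := by rw [hsum, Category.id_comp, hv]

/-- A morphism with a right inverse (a split monomorphism) can be replaced by an isometry. -/
theorem IsWStarCategory.exists_isometry (hC : IsWStarCategory C) {x y : C} {f : x ⟶ y}
    {g : y ⟶ x} (h : f ≫ g = 𝟙 x) : ∃ v : x ⟶ y, IsIsometry v := by
  obtain ⟨v, -, -, h3, -, -⟩ := hC.exists_polar f
  refine ⟨v, ?_⟩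
  have h4 := congrArg (· ≫ g) h3
  simp only [Category.assoc, h, Category.comp_id] at h4
  exact h4

/-- If `x` receives an orthogonal family of isometries from `ℵ_α` copies of each member of a
generating family, then every object embeds isometrically into `x`. -/
theorem IsWStarCategory.exists_isometry_of_isGenerating (hC : IsWStarCategory C) {α : Ordinal.{v}}
    (hsep : ∀ c : C, IsKappaSeparable (Cardinal.aleph (α + 1)) (End c)) {I J : Type v} {c : I → C}
    (hc : IsGenerating c) (hJ : Cardinal.mk J = Cardinal.aleph α) {x : C}
    (inc : ∀ a : I × J, c a.1 ⟶ x) (hinc : ∀ a, inc a ≫ adj (inc a) = 𝟙 (c a.1))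
    (horth : ∀ a b, a ≠ b → inc b ≫ adj (inc a) = 0) (y : C) : ∃ w : y ⟶ x, IsIsometry w := by
  -- Families of non-zero partial isometries from generators into `y` with pairwise orthogonal
  -- ranges.
  let P : Set (Set (Σ i, c i ⟶ y)) := {S | (∀ a ∈ S, a.2 ≫ adj a.2 ≫ a.2 = a.2 ∧ a.2 ≠ 0) ∧
    ∀ a ∈ S, ∀ b ∈ S, a ≠ b → a.2 ≫ adj b.2 = 0}
  obtain ⟨S, hS⟩ : ∃ S, Maximal (· ∈ P) S := by
    refine zorn_subset P fun F hF hchain => ⟨⋃₀ F, ⟨?_, ?_⟩,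
      fun s hs => Set.subset_sUnion_of_mem hs⟩
    · rintro a ⟨s, hs, ha⟩
      exact (hF hs).1 a ha
    · rintro a ⟨s, hs, ha⟩ b ⟨t, ht, hb⟩ hab
      rcases hchain.total hs ht with h | h
      · exact (hF ht).2 a (h ha) b hb hab
      · exact (hF hs).2 a ha b (h hb) hab
  obtain ⟨hS1, hS2⟩ := hS.prop
  have hpi : ∀ a : S, a.1.2 ≫ adj a.1.2 ≫ a.1.2 = a.1.2 := fun a => (hS1 a a.2).1
  have hpi' : ∀ a : S, adj a.1.2 ≫ a.1.2 ≫ adj a.1.2 = adj a.1.2 := by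
    intro a
    have := congrArg adj (hpi a)
    simpa only [StarCategory.adj_comp, StarCategory.adj_adj, Category.assoc] using this
  have hor : ∀ a b : S, a ≠ b → a.1.2 ≫ adj b.1.2 = 0 := fun a b h =>
    hS2 a a.2 b b.2 (fun h' => h (Subtype.ext h'))
  have hcard : Cardinal.mk S ≤ Cardinal.mk J := by
    rw [hJ]
    refine (hsep y).mk_le (fun a : S => (adj a.1.2 ≫ a.1.2 : y ⟶ y)) ?_ ?_ ?_
    · intro a h
      refine (hS1 a a.2).2 ?_
      have h' : adj a.1.2 ≫ a.1.2 = 0 := h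
      rw [← hpi a, h', Limits.comp_zero]
    · intro a
      change adj (adj a.1.2 ≫ a.1.2) = _
      rw [StarCategory.adj_comp, StarCategory.adj_adj]
    · intro a b hab
      change (adj b.1.2 ≫ b.1.2) ≫ adj a.1.2 ≫ a.1.2 = 0
      rw [Category.assoc, ← Category.assoc b.1.2, hor b a hab.symm, Limits.zero_comp,
        Limits.comp_zero]
  obtain ⟨j⟩ := (Cardinal.le_def _ _).1 hcard
  let t : S → I × J := fun a => (a.1.1, j a)
  have ht : ∀ a b, a ≠ b → t a ≠ t b := fun a b h h' => h (j.injective (Prod.ext_iff.1 h').2)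
  -- Each range in `y` is carried back to the source of `a` and into the copy labelled `j a`;
  -- injectivity of `j` keeps the images orthogonal.
  let w : ∀ a : S, y ⟶ x := fun a => adj a.1.2 ≫ inc (t a)
  have hadjw : ∀ a, adj (w a) = adj (inc (t a)) ≫ a.1.2 := fun a => by
    rw [StarCategory.adj_comp, StarCategory.adj_adj]
  have hww : ∀ a, w a ≫ adj (w a) = adj a.1.2 ≫ a.1.2 := by
    intro a
    rw [hadjw, Category.assoc, ← Category.assoc (inc (t a)), hinc]
    exact congrArg _ (Category.id_comp _)
  obtain ⟨v, hv, -, hv2, -, -⟩ := hC.exists_sum_partialIsometry w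
    (fun a => by
      rw [← Category.assoc, hww]
      change (adj a.1.2 ≫ a.1.2) ≫ adj a.1.2 ≫ inc (t a) = adj a.1.2 ≫ inc (t a)
      conv_rhs => rw [← hpi' a]
      simp only [Category.assoc])
    (fun a b h => by
      rw [hadjw, Category.assoc, ← Category.assoc (inc (t b)), horth _ _ (ht a b h),
        Limits.zero_comp, Limits.comp_zero])
    (fun a b h => by
      rw [hadjw, Category.assoc, ← Category.assoc b.1.2, hor b a h.symm, Limits.zero_comp,
        Limits.comp_zero])
  refine ⟨v, ?_⟩
  by_contra hne
  change ¬ v ≫ adj v = 𝟙 y at hne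
  have hvv : (v ≫ adj v) ≫ v ≫ adj v = v ≫ adj v := by
    calc (v ≫ adj v) ≫ v ≫ adj v = (v ≫ adj v ≫ v) ≫ adj v := by simp only [Category.assoc]
      _ = _ := by rw [hv]
  have hvv' : adj (v ≫ adj v) = v ≫ adj v := by rw [StarCategory.adj_comp, StarCategory.adj_adj]
  -- The part of `y` missed by `v`. The polar part `r` of a non-zero map from a generator into it
  -- has range orthogonal to all ranges in `S`.
  let Q : IdemCompletion C :=
    { X := y
      p := 𝟙 y - v ≫ adj v
      idem := by
        simp only [Preadditive.sub_comp, Preadditive.comp_sub, Category.id_comp, Category.comp_id,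
          hvv, sub_self, sub_zero]
      selfAdj := by rw [adj_sub, adj_id, hvv'] }
  have hQ : ¬ Limits.IsZero Q := by
    intro h
    have h1 : (𝟙 Q : Q ⟶ Q) = 0 := h.eq_of_src _ _
    have h2 : 𝟙 y - v ≫ adj v = 0 := congrArg Subtype.val h1
    exact hne (sub_eq_zero.1 h2).symm
  obtain ⟨i, f, hf⟩ := hc Q hQ
  have hf0 : f.1 ≠ 0 := fun h => hf (Subtype.ext h)
  have hfp : f.1 ≫ (𝟙 y - v ≫ adj v) = f.1 := IdemCompletion.comp_p f
  obtain ⟨r, hr, hr2, -, hr4, -⟩ := hC.exists_polar (f.1 : c i ⟶ y)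
  have hr0 : r ≠ 0 := by
    rintro rfl
    rw [Limits.comp_zero, Limits.comp_zero] at hr2
    exact hf0 hr2.symm
  have hrv : r ≫ v ≫ adj v = 0 := hr4 _ (by
    rw [Preadditive.comp_sub, Category.comp_id, sub_eq_self] at hfp
    exact hfp)
  have hra : ∀ a : S, r ≫ adj a.1.2 = 0 := by
    intro a
    have h1 := congrArg adj (hv2 a)
    rw [hww, StarCategory.adj_comp, hvv', StarCategory.adj_comp, StarCategory.adj_adj] at h1
    have h2 : r ≫ adj a.1.2 ≫ a.1.2 = 0 := by
      rw [← h1, ← Category.assoc, hrv, Limits.zero_comp]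
    rw [← hpi' a]
    calc r ≫ adj a.1.2 ≫ a.1.2 ≫ adj a.1.2 = (r ≫ adj a.1.2 ≫ a.1.2) ≫ adj a.1.2 := by
          simp only [Category.assoc]
      _ = 0 := by rw [h2, Limits.zero_comp]
  have hra' : ∀ a : S, a.1.2 ≫ adj r = 0 := by
    intro a
    have := congrArg adj (hra a)
    rwa [StarCategory.adj_comp, StarCategory.adj_adj, adj_zero] at this
  have hmem : insert (⟨i, r⟩ : Σ i, c i ⟶ y) S ∈ P := by
    refine ⟨?_, ?_⟩
    · rintro a (rfl | ha)
      · exact ⟨hr, hr0⟩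
      · exact hS1 a ha
    · rintro a (rfl | ha) b (rfl | hb) hab
      · exact absurd rfl hab
      · exact hra ⟨b, hb⟩
      · exact hra' ⟨a, ha⟩
      · exact hS2 a ha b hb hab
  -- Maximality puts `r` in `S`, so `r` is orthogonal to itself and must vanish.
  have hin : (⟨i, r⟩ : Σ i, c i ⟶ y) ∈ S :=
    hS.le_of_ge hmem (Set.subset_insert _ _) (Set.mem_insert _ _)
  exact hr0 (hC.eq_zero_of_comp_adj (hra ⟨_, hin⟩))

/-- In an `ℵ_{α+1}`-small and `ℵ_{α+1}`-complete W*-category there is a generator into which every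
object embeds isometrically. -/
theorem IsWStarCategory.exists_isMaximal (hC : IsWStarCategory C) {α : Ordinal.{v}}
    (hsmall : IsKappaSmall C (Cardinal.aleph (α + 1)))
    (hsums : HasKappaSmallSums C (Cardinal.aleph (α + 1))) :
    ∃ x : C, IsGenerator x ∧ ∀ y : C, ∃ w : y ⟶ x, IsIsometry w := by
  obtain ⟨hsep, I, c, hI, hc⟩ := hsmall
  have hlt : Cardinal.aleph α < Cardinal.aleph (α + 1) :=
    Cardinal.aleph_lt_aleph.2 (lt_add_one α)
  let J : Type v := (Cardinal.aleph α).out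
  have hJ : Cardinal.mk J = Cardinal.aleph α := Cardinal.mk_out _
  -- The index set `J` supplies `ℵ_α` copies of each generator, and `I × J` still has fewer than
  -- `ℵ_{α+1}` elements.
  obtain ⟨x, inc, h1, h2, -⟩ := hsums (I × J)
    (by
      rw [Cardinal.mk_prod, Cardinal.lift_id, Cardinal.lift_id]
      exact Cardinal.mul_lt_of_lt (Cardinal.aleph0_le_aleph _) hI (hJ.trans_lt hlt))
    (fun a => c a.1)
  refine ⟨x, fun P hP => ?_, hC.exists_isometry_of_isGenerating hsep hc hJ inc h1 h2⟩
  obtain ⟨i, f, hf⟩ := hc P hP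
  have hJ0 : Cardinal.mk J ≠ 0 := by
    rw [hJ]
    exact (Cardinal.aleph_pos α).ne'
  obtain ⟨j⟩ := Cardinal.mk_ne_zero_iff.1 hJ0
  let g : IdemCompletion.of (c i) ⟶ IdemCompletion.of x := ⟨inc (i, j), by
    change 𝟙 _ ≫ inc (i, j) ≫ 𝟙 x = inc (i, j)
    rw [Category.id_comp, Category.comp_id]⟩
  have hg : g ≫ adj g = 𝟙 _ := Subtype.ext (h1 (i, j))
  refine ⟨(), adj g ≫ f, fun h => hf ?_⟩
  have h3 : g ≫ adj g ≫ f = 0 := by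
    have h' : adj g ≫ f = 0 := h
    rw [h', Limits.comp_zero]
  rwa [← Category.assoc, hg, Category.id_comp] at h3

end Comparison

/-! ### Normality of fully faithful *-functors. -/

section Normality

/-- Suprema depend on the order alone, so surjectivity together with preservation and reflection of
the order suffices, with no topology. -/
theorem isNormalMap_of_starLE_iff {A : Type v} {B : Type u} [Ring A] [Star A] [Ring B] [Star B]
    {f : A → B} (hf : Function.Surjective f) (h : ∀ a b, StarLE (f a) (f b) ↔ StarLE a b) :
    IsNormalMap f := by
  intro S _ _ _ s hs
  refine ⟨?_, fun b hb => ?_⟩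
  · rintro _ ⟨a, ha, rfl⟩
    exact (h a s).2 (hs.1 a ha)
  · obtain ⟨b, rfl⟩ := hf b
    exact (h s b).2 (hs.2 b fun a ha => (h a b).1 (hb _ ⟨a, ha, rfl⟩))

variable {C : Type u} [Category.{v} C] [Preadditive C] [Linear ℂ C] [StarCategory C]
variable {D : Type u'} [Category.{v} D] [Preadditive D] [Linear ℂ D] [StarCategory D]

/-- A fully faithful linear *-functor is a functor of W*-categories. -/
theorem isWStarFunctor_of_full_faithful (F : C ⥤ D) [F.Full] [F.Faithful] [F.Additive]
    [F.Linear ℂ] (hF : ∀ {X Y : C} (f : X ⟶ Y), F.map (adj f) = adj (F.map f)) :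
    IsWStarFunctor F := by
  refine ⟨inferInstance, inferInstance, hF, fun X => ?_⟩
  -- Fullness and faithfulness act entrywise on matrices, so the induced map is a *-isomorphism and
  -- respects differences of the form `t* t` both ways.
  have hsurj : Function.Surjective fun f : X ⟶ X => F.mapMat_.map f := by
    intro g
    choose k hk using fun i j => F.map_surjective (g i j)
    exact ⟨k, Mat_.hom_ext _ _ hk⟩
  have hinj : Function.Injective fun f : X ⟶ X => F.mapMat_.map f := by
    intro f g h
    exact Mat_.hom_ext _ _ fun i j => F.map_injective (congrFun (congrFun h i) j)
  have hstar : ∀ t : X ⟶ X, F.mapMat_.map (adj t) = adj (F.mapMat_.map t) := fun t =>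
    Mat_.hom_ext _ _ fun i j => hF (t j i)
  have hsub : ∀ a b : X ⟶ X, F.mapMat_.map (a - b) = F.mapMat_.map a - F.mapMat_.map b :=
    fun a b => Mat_.hom_ext _ _ fun i j => F.map_sub
  refine isNormalMap_of_starLE_iff hsurj fun a b => ⟨?_, ?_⟩
  · rintro ⟨t, ht⟩
    obtain ⟨t, rfl⟩ := hsurj t
    refine ⟨t, hinj ?_⟩
    change F.mapMat_.map ((b : X ⟶ X) - a) = F.mapMat_.map (t ≫ adj t)
    rw [hsub, F.mapMat_.map_comp, hstar]
    exact ht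
  · rintro ⟨t, ht⟩
    refine ⟨F.mapMat_.map t, ?_⟩
    change F.mapMat_.map b - F.mapMat_.map a = F.mapMat_.map t ≫ adj (F.mapMat_.map t)
    rw [← hstar, ← F.mapMat_.map_comp, ← hsub]
    exact congrArg _ ht

end Normality

/-! ### Equivalence with the idempotent completion of `𝐁(End c)`. -/

section Corner

variable {C : Type u} [Category.{v} C] [Preadditive C] [Linear ℂ C] [StarCategory C]

instance instStarModuleEnd (c : C) : StarModule ℂ (End c) where
  star_smul z f := StarCategory.adj_smul z (f : c ⟶ c)

variable {c : C}

/-- The object of the idempotent completion of `𝐁(End c)` given by a projection of `c`. -/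
def projectionObj (p : c ⟶ c) (hp : p ≫ p = p) (hp' : adj p = p) :
    IdemCompletion (SingleObj (End c)) where
  X := SingleObj.star (End c)
  p := p
  idem := hp
  selfAdj := hp'

/-- The projection of `c` underlying an object of the idempotent completion of `𝐁(End c)`. -/
def IdemCompletion.proj (P : IdemCompletion (SingleObj (End c))) : c ⟶ c := P.p

theorem IdemCompletion.proj_comp_proj (P : IdemCompletion (SingleObj (End c))) :
    P.proj ≫ P.proj = P.proj := P.idem

theorem IdemCompletion.adj_proj (P : IdemCompletion (SingleObj (End c))) :
    adj P.proj = P.proj := P.selfAdj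

/-- The endomorphism of `c` underlying a morphism. -/
def IdemCompletion.toEnd {P Q : IdemCompletion (SingleObj (End c))} (f : P ⟶ Q) : c ⟶ c := f.1

/-- A morphism of the idempotent completion of `𝐁(End c)` from an endomorphism of `c`. -/
def IdemCompletion.ofEnd {P Q : IdemCompletion (SingleObj (End c))} (f : c ⟶ c)
    (hf : P.proj ≫ f ≫ Q.proj = f) : P ⟶ Q := ⟨f, hf⟩

open IdemCompletion

theorem IdemCompletion.ext_toEnd {P Q : IdemCompletion (SingleObj (End c))} {f g : P ⟶ Q}
    (h : toEnd f = toEnd g) : f = g := Subtype.ext h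

theorem IdemCompletion.proj_comp_toEnd {P Q : IdemCompletion (SingleObj (End c))} (f : P ⟶ Q) :
    P.proj ≫ toEnd f = toEnd f := p_comp f

theorem IdemCompletion.toEnd_comp_proj {P Q : IdemCompletion (SingleObj (End c))} (f : P ⟶ Q) :
    toEnd f ≫ Q.proj = toEnd f := comp_p f

/-- Isometries of all objects into `c` and splittings of all projections of `c` give an equivalence
with the idempotent completion of `𝐁(End c)`. -/
theorem wStarEquivalent_of_isometries {ι : ∀ y : C, y ⟶ c} (hι : ∀ y, ι y ≫ adj (ι y) = 𝟙 y)
    {o : IdemCompletion (SingleObj (End c)) → C} {i : ∀ P, o P ⟶ c}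
    (hi : ∀ P, i P ≫ adj (i P) = 𝟙 (o P)) (hp : ∀ P, adj (i P) ≫ i P = P.proj) :
    WStarEquivalent C (IdemCompletion (SingleObj (End c))) := by
  have hι₂ : ∀ {y z : C} (f : y ⟶ z), ι y ≫ adj (ι y) ≫ f = f := fun f => by
    rw [← Category.assoc, hι, Category.id_comp]
  have hi₂ : ∀ {P} {z : C} (f : o P ⟶ z), i P ≫ adj (i P) ≫ f = f := fun f => by
    rw [← Category.assoc, hi, Category.id_comp]
  have hp₂ : ∀ {P} {z : C} (f : c ⟶ z), adj (i P) ≫ i P ≫ f = P.proj ≫ f := fun f => by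
    rw [← Category.assoc, hp]
  let obj : C → IdemCompletion (SingleObj (End c)) := fun y => projectionObj (adj (ι y) ≫ ι y)
    (by rw [Category.assoc, hι₂]) (by rw [StarCategory.adj_comp, StarCategory.adj_adj])
  have hobj : ∀ y, (obj y).proj = adj (ι y) ≫ ι y := fun y => rfl
  -- `F` transports morphisms to `c` along the embeddings `ι`; `G` below compresses them to the
  -- chosen splittings `i`.
  let F : C ⥤ IdemCompletion (SingleObj (End c)) :=
    { obj := obj
      map := fun {y z} f => ofEnd (adj (ι y) ≫ f ≫ ι z) (by
        simp only [hobj, Category.assoc, hι₂])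
      map_id := fun y => ext_toEnd (by
        change adj (ι y) ≫ 𝟙 y ≫ ι y = adj (ι y) ≫ ι y
        rw [Category.id_comp])
      map_comp := fun {x y z} f g => ext_toEnd (by
        change adj (ι x) ≫ (f ≫ g) ≫ ι z = (adj (ι x) ≫ f ≫ ι y) ≫ adj (ι y) ≫ g ≫ ι z
        simp only [Category.assoc, hι₂]) }
  let G : IdemCompletion (SingleObj (End c)) ⥤ C :=
    { obj := o
      map := fun {P Q} f => i P ≫ toEnd f ≫ adj (i Q)
      map_id := fun P => by
        change i P ≫ P.proj ≫ adj (i P) = 𝟙 _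
        rw [← hp, Category.assoc, hi₂, hi]
      map_comp := fun {P Q R} f g => by
        change i P ≫ (toEnd f ≫ toEnd g) ≫ adj (i R) = _
        simp only [Category.assoc, hp₂]
        rw [← Category.assoc Q.proj, proj_comp_toEnd] }
  let e : C ≌ IdemCompletion (SingleObj (End c)) :=
    { functor := F
      inverse := G
      -- `y` and `o (obj y)` split the same projection of `c`, so `ι y ≫ adj (i (obj y))` is a
      -- unitary between them.
      unitIso := NatIso.ofComponents
        (fun y =>
          { hom := ι y ≫ adj (i (obj y))
            inv := i (obj y) ≫ adj (ι y)
            hom_inv_id := by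
              change (ι y ≫ adj (i (obj y))) ≫ i (obj y) ≫ adj (ι y) = 𝟙 y
              rw [Category.assoc, hp₂, hobj, Category.assoc, hι₂, hι]
            inv_hom_id := by
              change (i (obj y) ≫ adj (ι y)) ≫ ι y ≫ adj (i (obj y)) = 𝟙 (o (obj y))
              have : adj (ι y) ≫ ι y ≫ adj (i (obj y)) = adj (i (obj y)) := by
                rw [← Category.assoc, ← hobj, ← hp, Category.assoc, hi, Category.comp_id]
              rw [Category.assoc, this, hi] })
        (fun {y z} f => by
          change f ≫ ι z ≫ adj (i (obj z)) = (ι y ≫ adj (i (obj y))) ≫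
            i (obj y) ≫ (adj (ι y) ≫ f ≫ ι z) ≫ adj (i (obj z))
          simp only [Category.assoc, hp₂, hobj, hι₂])
      counitIso := NatIso.ofComponents
        (fun P =>
          { hom := ofEnd (adj (ι (o P)) ≫ i P) (by
              change (adj (ι (o P)) ≫ ι (o P)) ≫ (adj (ι (o P)) ≫ i P) ≫ P.proj = _
              simp only [← hp, Category.assoc, hι₂, hi₂])
            inv := ofEnd (adj (i P) ≫ ι (o P)) (by
              change P.proj ≫ (adj (i P) ≫ ι (o P)) ≫ adj (ι (o P)) ≫ ι (o P) = _
              simp only [← hp, Category.assoc, hι₂, hi₂])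
            hom_inv_id := ext_toEnd (by
              change (adj (ι (o P)) ≫ i P) ≫ adj (i P) ≫ ι (o P) = adj (ι (o P)) ≫ ι (o P)
              rw [Category.assoc, hi₂])
            inv_hom_id := ext_toEnd (by
              change (adj (i P) ≫ ι (o P)) ≫ adj (ι (o P)) ≫ i P = P.proj
              rw [Category.assoc, hι₂, hp]) })
        (fun {P Q} f => ext_toEnd (by
          change (adj (ι (o P)) ≫ (i P ≫ toEnd f ≫ adj (i Q)) ≫ ι (o Q)) ≫ adj (ι (o Q)) ≫ i Q =
            (adj (ι (o P)) ≫ i P) ≫ toEnd f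
          simp only [Category.assoc, hι₂, hp, toEnd_comp_proj]))
      functor_unitIso_comp := fun y => ext_toEnd (by
        change (adj (ι y) ≫ (ι y ≫ adj (i (obj y))) ≫ ι (o (obj y))) ≫
          adj (ι (o (obj y))) ≫ i (obj y) = adj (ι y) ≫ ι y
        simp only [Category.assoc, hι₂, hp, hobj]) }
  have : F.IsEquivalence := e.isEquivalence_functor
  have : G.IsEquivalence := e.isEquivalence_inverse
  have : F.Additive := ⟨fun {y z f g} => ext_toEnd (by
    change adj (ι y) ≫ (f + g) ≫ ι z = adj (ι y) ≫ f ≫ ι z + adj (ι y) ≫ g ≫ ι z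
    rw [Preadditive.add_comp, Preadditive.comp_add])⟩
  have : F.Linear ℂ := ⟨fun {y z} f r => ext_toEnd (by
    change adj (ι y) ≫ (r • f) ≫ ι z = r • (adj (ι y) ≫ f ≫ ι z)
    rw [Linear.smul_comp, Linear.comp_smul])⟩
  have : G.Additive := ⟨fun {P Q f g} => by
    change i P ≫ (toEnd f + toEnd g) ≫ adj (i Q) = _
    rw [Preadditive.add_comp, Preadditive.comp_add]⟩
  have : G.Linear ℂ := ⟨fun {P Q} f r => by
    change i P ≫ (r • toEnd f) ≫ adj (i Q) = _
    rw [Linear.smul_comp, Linear.comp_smul]⟩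
  refine ⟨e, isWStarFunctor_of_full_faithful F fun {y z} f => ext_toEnd ?_,
    isWStarFunctor_of_full_faithful G fun {P Q} f => ?_, fun y => ?_, fun P => ext_toEnd ?_⟩
  · change adj (ι z) ≫ adj f ≫ ι y = adj (adj (ι y) ≫ f ≫ ι z)
    simp only [StarCategory.adj_comp, StarCategory.adj_adj, Category.assoc]
  · change i Q ≫ adj (toEnd f) ≫ adj (i P) = adj (i P ≫ toEnd f ≫ adj (i Q))
    simp only [StarCategory.adj_comp, StarCategory.adj_adj, Category.assoc]
  · change i (obj y) ≫ adj (ι y) = adj (ι y ≫ adj (i (obj y)))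
    rw [StarCategory.adj_comp, StarCategory.adj_adj]
  · change adj (i P) ≫ ι (o P) = adj (adj (ι (o P)) ≫ i P)
    rw [StarCategory.adj_comp, StarCategory.adj_adj]

/-- An idempotent complete *-category all of whose objects embed isometrically into `c` is
equivalent to the idempotent completion of `𝐁(End c)`. -/
theorem IsIdempotentComplete.wStarEquivalent (hC : IsIdempotentComplete C)
    (hc : ∀ y : C, ∃ w : y ⟶ c, IsIsometry w) :
    WStarEquivalent C (IdemCompletion (SingleObj (End c))) := by
  choose ι hι using hc
  choose o i hp hi using fun P : IdemCompletion (SingleObj (End c)) =>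
    hC c P.proj P.proj_comp_proj P.adj_proj
  exact wStarEquivalent_of_isometries hι hi hp

end Corner

end WCat

theorem mainTheorem11 {C : Type u} [Category.{v} C] [Preadditive C] [Linear ℂ C]
    [WCat.StarCategory C] (hC : WCat.IsWStarCategory C)
    (α : Ordinal.{v}) (κ : Cardinal.{v}) (hκ : κ = Cardinal.aleph (α + 1))
    (hsmall : WCat.IsKappaSmall C κ) (hcomplete : WCat.IsKappaComplete C κ) :
    (∃ c : C, WCat.IsMaximal c ∧
      ∀ c' : C, WCat.IsMaximal c' → ∃ e : c ≅ c', WCat.IsUnitaryIso e) ∧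
    (∃ (A : Type v) (_ : Ring A) (_ : StarRing A) (_ : Algebra ℂ A) (_ : StarModule ℂ A),
      WCat.IsKappaSeparable κ A ∧
      WCat.WStarEquivalent C (WCat.IdemCompletion (SingleObj A))) := by
  subst hκ
  obtain ⟨c, hgen, hc⟩ := hC.exists_isMaximal hsmall hcomplete.2
  refine ⟨⟨c, ⟨hgen, fun y => ?_⟩, fun c' hc' => ?_⟩, End c, inferInstance, inferInstance,
    inferInstance, inferInstance, hsmall.1 c, hcomplete.1.wStarEquivalent hc⟩
  · obtain ⟨w, hw⟩ := hc y
    exact ⟨y, w, hw, ⟨Iso.refl y⟩⟩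
  · obtain ⟨y, i, hi, ⟨e⟩⟩ := hc'.2 c
    -- The isomorphism of `c` with a subobject of `c'` need not be unitary, so the composite is only
    -- a split monomorphism; its polar part is the isometry wanted.
    obtain ⟨u, hu⟩ := hC.exists_isometry (f := e.hom ≫ i) (g := WCat.StarCategory.adj i ≫ e.inv) (by
      change i ≫ WCat.StarCategory.adj i = 𝟙 y at hi
      rw [Category.assoc, ← Category.assoc i, hi, Category.id_comp, e.hom_inv_id])
    obtain ⟨w, hw⟩ := hc c'
    exact hC.exists_unitaryIso hu hw
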